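/- Let $n\ge 1$, let $P(\lambda)=\lambda^2A_2+\lambda A_1+A_0$ with $A_0,A_1,A_2\in\mathbb{C}^{n\times n}$ and $A_2$ invertible, let $\|\cdot\|$ be the operator norm induced by the Euclidean norm, let $\gamma_i=\|A_i\|$, and let $\operatorname{cond}A=\|A\|\,\|A^{-1}\|$ (with $\operatorname{cond}A=+\infty$ and $(\operatorname{cond}A)^{-1}=0$ if $A$ is singular). A tropical root of the max-times polynomial $p(x)=\max(\gamma_0,\gamma_1x,\gamma_2x^2)$ is a real $x\ge 0$ at which the maximum is attained by at least two of the three monomials. Assume that $p$ has two distinct tropical roots $\alpha^+>\alpha^-$. Then $\alpha^+=\gamma_1/\gamma_2$ and $\alpha^-=\gamma_0/\gamma_1$. Put $\delta=\alpha^+/\alpha^-$ (if $A_0=0$, then $\alpha^-=0$, $\delta=+\infty$, and the right-hand side of the first bound below is read as $0$). Counted with multiplicity as roots of the determinant, $P$ has exactly $2n$ eigenvalues $\lambda_1,\dots,\lambda_{2n}$ and the pencil $\lambda A_2+A_1$ has exactly $n$ eigenvalues $\xi_1,\dots,\xi_n$. Put $\xi_{n+1}=\dots=\xi_{2n}=0$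 and $$v(\operatorname{spec}P,\xi)=\min_{\pi\in S_{2n}}\ \max_{1\le i\le 2n}\ |\xi_{\pi(i)}-\lambda_i| .$$ Then $$v(\operatorname{spec}P,\xi)\le \frac{C\,\alpha^+}{\delta^{1/(2n)}},\qquad C=4\cdot 2^{-1/(2n)}\Bigl(2+2\operatorname{cond}A_2+\frac{\operatorname{cond}A_2}{\delta}\Bigr)^{1-\frac1{2n}}(\operatorname{cond}A_2)^{\frac1{2n}},$$ and $$\alpha^+(\operatorname{cond}A_1)^{-1}\le|\xi_i|\le\alpha^+\operatorname{cond}A_2,\qquad 1\le i\le n .$$ -/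

import Mathlib

/- The norm on complex square matrices is the operator norm induced by the Euclidean norm. -/
open scoped Matrix.Norms.L2Operator

namespace TropicalSplitting

noncomputable section

/-- The max-times polynomial function `x ↦ max_{0 ≤ k ≤ d} γ_k x^k`. -/
def maxTimesEval {d : ℕ} (γ : Fin (d + 1) → ℝ) (x : ℝ) : ℝ :=
  Finset.univ.sup' Finset.univ_nonempty fun k : Fin (d + 1) => γ k * x ^ (k : ℕ)

/-- A tropical root of a max-times polynomial: a point of the max-times semiring (a nonnegative
real number) at which the maximum is attained by at least two monomials. -/
def IsTropicalRoot {d : ℕ} (γ : Fin (d + 1) → ℝ) (x : ℝ) : Prop :=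
  0 ≤ x ∧ ∃ i j : Fin (d + 1), i ≠ j ∧
    γ i * x ^ (i : ℕ) = maxTimesEval γ x ∧ γ j * x ^ (j : ℕ) = maxTimesEval γ x

/-- The matrix polynomial `A_0 + λ A_1 + ⋯ + λ^d A_d`, as a matrix with polynomial entries. -/
def matrixPoly {n d : ℕ} (A : Fin (d + 1) → Matrix (Fin n) (Fin n) ℂ) :
    Matrix (Fin n) (Fin n) (Polynomial ℂ) :=
  ∑ k : Fin (d + 1), (Polynomial.X : Polynomial ℂ) ^ (k : ℕ) • (A k).map Polynomial.C

/-- The (finite) eigenvalues of a matrix polynomial, with multiplicities: the roots of its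
determinant. -/
def spec {n d : ℕ} (A : Fin (d + 1) → Matrix (Fin n) (Fin n) ℂ) : Multiset ℂ :=
  (matrixPoly A).det.roots

/-- `IsEnumeration s x`: the finite sequence `x` lists the multiset `s` with multiplicities. -/
def IsEnumeration {m : ℕ} (s : Multiset ℂ) (x : Fin m → ℂ) : Prop :=
  (Finset.univ : Finset (Fin m)).val.map x = s

/-- The eigenvalue variation `min_π max_i |μ_{π(i)} - λ_i|` of two sequences of length `m`.
The index sets are finite, so the infimum and the supremum are a minimum and a maximum. -/
def variation {m : ℕ} (lam mu : Fin m → ℂ) : ℝ :=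
  ⨅ π : Equiv.Perm (Fin m), ⨆ i : Fin m, ‖mu (π i) - lam i‖

/-- The condition number `‖A‖ ‖A⁻¹‖` of an invertible matrix. (A singular matrix has infinite
condition number, with reciprocal `0`; here its `cond` is `0`, and again `(cond A)⁻¹ = 0`.) -/
def cond {n : ℕ} (A : Matrix (Fin n) (Fin n) ℂ) : ℝ :=
  ‖A‖ * ‖A⁻¹‖

/-- `4 · 2^{-1/(2n)} (2 + 2κ + κ/δ)^{1 - 1/(2n)} κ^{1/(2n)}`. -/
def splittingConst (n : ℕ) (κ δ : ℝ) : ℝ :=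
  4 * (2 : ℝ) ^ (-(1 / (2 * (n : ℝ)))) * (2 + 2 * κ + κ / δ) ^ (1 - 1 / (2 * (n : ℝ)))
    * κ ^ (1 / (2 * (n : ℝ)))

end

end TropicalSplitting

namespace TropicalSplitting

section

open Polynomial Finset Filter Topology

/-! After division by `A₂`, the eigenvalues of `P` are those of a 2n × 2n companion matrix. Dropping
`A₀` leaves a block triangular matrix with spectrum ξ and n zeros. Scaling by α⁺ makes this
perturbation at most α⁺κ/δ in norm and the two norms sum to at most α⁺(2 + 2κ + κ/δ), where κ = cond
`A₂`. The bound is then the Bhatia–Elsner–Krause theorem `variation_le_of_charpoly_eq` with N = 2n.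

That theorem rests on three facts. Along the segment from A to B all eigenvalues stay in a sublevel
set of |χ_A| (`norm_eval_charpoly_le`). The number of eigenvalues in each component of this set is
constant (`exists_perm_connectedComponentIn_eq`). Each component has small diameter, by Chebyshev
(`dist_le_of_isPreconnected`).

The bounds on |ξ_i| come from the norms of `A₂⁻¹ * A₁` and of its inverse. -/

/-! ### Roots of monic polynomials: sublevel sets and deformation. -/

theorem exists_perm_of_map_univ_eq {ι β : Type*} [Fintype ι] {f g : ι → β}
    (h : (univ : Finset ι).val.map f = (univ : Finset ι).val.map g) :
    ∃ π : Equiv.Perm ι, ∀ i, g (π i) = f i := by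
  classical
  have hc : ∀ c, Nonempty ({i // f i = c} ≃ {i // g i = c}) := fun c => by
    have := congrArg (Multiset.count c) h
    rw [Multiset.count_map, Multiset.count_map] at this
    refine ⟨Fintype.equivOfCardEq ?_⟩
    rw [Fintype.card_subtype, Fintype.card_subtype]
    simpa only [Finset.card, Finset.filter_val, eq_comm] using this
  exact ⟨Equiv.ofFiberEquiv fun c => (hc c).some, fun i => Equiv.ofFiberEquiv_map _ i⟩

/-- **Chebyshev's inequality** for monic polynomials on an interval. -/
theorem chebyshev_le_of_forall_abs_le {P : ℝ[X]} (hP : P.Monic) (hN : P.natDegree ≠ 0)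
    {a b M : ℝ} (hab : a < b) (hM : 0 < M) (h : ∀ x ∈ Set.Icc a b, |P.eval x| ≤ M) :
    2 * ((b - a) / 4) ^ P.natDegree ≤ M := by
  set N := P.natDegree with hNdef
  set L : ℝ[X] := C ((b - a) / 2) * X + C ((a + b) / 2) with hL
  have hb : (b - a) / 2 ≠ 0 := by linarith
  have hLd : L.natDegree = 1 := natDegree_linear hb
  have hLl : L.leadingCoeff = (b - a) / 2 := leadingCoeff_linear hb
  have hdeg : (P.comp L).natDegree = N := by rw [natDegree_comp, hLd, mul_one]
  have hco : (P.comp L).coeff N = ((b - a) / 2) ^ N := by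
    rw [← hdeg, coeff_natDegree, leadingCoeff_comp (by rw [hLd]; exact one_ne_zero), hP.leadingCoeff,
      hLl, one_mul, hdeg]
  -- `L` maps [-1, 1] onto [a, b]; a degree-N polynomial bounded by 1 on [-1, 1] has leading
  -- coefficient at most 2^(N-1).
  have key := Polynomial.Chebyshev.coeff_le_of_forall_abs_le_one (n := N)
    (P := C M⁻¹ * P.comp L)
    (natDegree_le_iff_degree_le.mp ((natDegree_C_mul_le _ _).trans hdeg.le)) (by
      rintro x ⟨hx1, hx2⟩
      have hx : L.eval x ∈ Set.Icc a b := by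
        simp only [hL, eval_add, eval_mul, eval_C, eval_X]
        constructor <;> nlinarith
      rw [eval_mul, eval_C, eval_comp, abs_mul, abs_of_pos (inv_pos.mpr hM), inv_mul_le_iff₀ hM,
        mul_one]
      exact h _ hx)
  rw [coeff_C_mul, hco, inv_mul_le_iff₀ hM] at key
  obtain ⟨k, hk⟩ := Nat.exists_eq_succ_of_ne_zero hN
  rw [hk] at key ⊢
  have h4 : ((b - a) / 4) ^ (k + 1) = ((b - a) / 2) ^ (k + 1) / 2 ^ (k + 1) := by
    rw [← div_pow]; ring
  rw [Nat.succ_eq_add_one] at *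
  rw [h4, pow_succ 2 k, mul_div_assoc', div_le_iff₀ (by positivity)]
  simp only [Nat.add_sub_cancel] at key
  linarith

/-- A preconnected set on which a monic polynomial is small has small diameter. -/
theorem dist_le_of_isPreconnected {ι : Type*} [Fintype ι] [Nonempty ι] {S : Set ℂ}
    (hS : IsPreconnected S) {a b : ℂ} (ha : a ∈ S) (hb : b ∈ S) (c : ι → ℂ) {M : ℝ} (hM : 0 < M)
    (h : ∀ z ∈ S, ∏ i, ‖z - c i‖ ≤ M) :
    2 * (‖b - a‖ / 4) ^ Fintype.card ι ≤ M := by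
  rcases eq_or_ne a b with rfl | hab
  · simp [Fintype.card_ne_zero, hM.le]
  have hpos : 0 < ‖b - a‖ := norm_pos_iff.mpr (sub_ne_zero.mpr hab.symm)
  -- `φ` is orthogonal projection onto the direction of b - a. Projecting the roots only shrinks the
  -- factors, and by connectedness the image of `S` covers an interval of length |b - a|, so the
  -- real Chebyshev inequality applies.
  set u : ℂ := (starRingEnd ℂ) (b - a) / (‖b - a‖ : ℂ) with hu
  have hun : ‖u‖ = 1 := by
    rw [hu, norm_div, RCLike.norm_conj, Complex.norm_real, norm_norm, div_self hpos.ne']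
  set φ : ℂ → ℝ := fun z => (u * z).re with hφ
  have hφc : Continuous φ := by fun_prop
  have hφl : ∀ z w, |φ z - φ w| ≤ ‖z - w‖ := fun z w => by
    have : φ z - φ w = (u * (z - w)).re := by simp [hφ, mul_sub]
    rw [this]
    exact (Complex.abs_re_le_norm _).trans (by rw [norm_mul, hun, one_mul])
  have hφab : φ b - φ a = ‖b - a‖ := by
    have h1 : φ b - φ a = (u * (b - a)).re := by simp [hφ, mul_sub]
    have h2 : u * (b - a) = (‖b - a‖ : ℂ) := by
      have : (‖b - a‖ : ℂ) ≠ 0 := by exact_mod_cast hpos.ne'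
      rw [hu, div_mul_eq_mul_div, mul_comm, Complex.mul_conj, Complex.normSq_eq_norm_sq]
      field_simp
      push_cast
      ring
    rw [h1, h2, Complex.ofReal_re]
  have hsub : Set.Icc (φ a) (φ b) ⊆ φ '' S :=
    (hS.image φ hφc.continuousOn).Icc_subset ⟨a, ha, rfl⟩ ⟨b, hb, rfl⟩
  have hdeg : (∏ i, (X - C (φ (c i)))).natDegree = Fintype.card ι := by
    rw [natDegree_prod_of_monic _ _ fun i _ => monic_X_sub_C _]; simp
  have := chebyshev_le_of_forall_abs_le (P := ∏ i, (X - C (φ (c i)))) (a := φ a) (b := φ b)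
    (monic_prod_of_monic _ _ fun i _ => monic_X_sub_C _) (by rw [hdeg]; exact Fintype.card_ne_zero)
    (by linarith) hM (fun x hx => by
      obtain ⟨z, hz, rfl⟩ := hsub hx
      rw [eval_prod, abs_prod]
      refine le_trans (prod_le_prod (fun i _ => abs_nonneg _) fun i _ => ?_) (h z hz)
      simpa using hφl z (c i))
  rwa [hdeg, hφab] at this

theorem roots_prod_X_sub_C_univ {ι : Type*} [Fintype ι] (x : ι → ℂ) :
    (∏ i, (X - C (x i))).roots = (univ : Finset ι).val.map x := by
  have := roots_multiset_prod_X_sub_C ((univ : Finset ι).val.map x)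
  rwa [Multiset.map_map] at this

theorem map_univ_eq_of_prod_sub_eq {ι : Type*} [Fintype ι] {x y : ι → ℂ}
    (h : ∀ z, ∏ i, (z - x i) = ∏ i, (z - y i)) :
    (univ : Finset ι).val.map x = (univ : Finset ι).val.map y := by
  rw [← roots_prod_X_sub_C_univ, ← roots_prod_X_sub_C_univ]
  congr 1
  exact Polynomial.funext fun z => by simpa [eval_prod] using h z

/-- Along a continuous path of monic polynomials whose roots stay in an open set `U`, the number of
roots in each connected component of `U` is constant. -/
theorem exists_perm_connectedComponentIn_eq {ι : Type*} [Fintype ι] {U : Set ℂ} (hU : IsOpen U)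
    {R : ℝ} {G : ℝ → ℂ → ℂ} (hG : ∀ z, Continuous fun t => G t z)
    (hex : ∀ t ∈ Set.Icc (0 : ℝ) 1, ∃ x : ι → ℂ, ∀ z, ∏ i, (z - x i) = G t z)
    (hroot : ∀ t ∈ Set.Icc (0 : ℝ) 1, ∀ z, G t z = 0 → z ∈ U ∧ ‖z‖ ≤ R)
    {x y : ι → ℂ} (hx : ∀ z, ∏ i, (z - x i) = G 0 z) (hy : ∀ z, ∏ i, (z - y i) = G 1 z) :
    ∃ π : Equiv.Perm ι, ∀ i,
      connectedComponentIn U (y (π i)) = connectedComponentIn U (x i) := by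
  -- The invariant: the multiset of components of `U` containing the roots. It is locally constant
  -- in the root vector, since components of an open set are open.
  set c : (ι → ℂ) → Multiset (Set ℂ) :=
    fun x => (univ : Finset ι).val.map fun i => connectedComponentIn U (x i) with hc
  have hceq : ∀ {t : ℝ} {x y : ι → ℂ}, (∀ z, ∏ i, (z - x i) = G t z) →
      (∀ z, ∏ i, (z - y i) = G t z) → c x = c y := fun {t x y} h1 h2 => by
    have := congrArg (Multiset.map (connectedComponentIn U))
      (map_univ_eq_of_prod_sub_eq fun z => (h1 z).trans (h2 z).symm)
    simpa only [Multiset.map_map, hc, Function.comp_def] using this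
  set Z : Set (ℝ × (ι → ℂ)) :=
    {q | q.1 ∈ Set.Icc (0 : ℝ) 1 ∧ ∀ z, ∏ i, (z - q.2 i) = G q.1 z} with hZ
  have hZroot : ∀ q ∈ Z, ∀ i, q.2 i ∈ U ∧ ‖q.2 i‖ ≤ R := fun q hq i =>
    hroot q.1 hq.1 _ (by rw [← hq.2]; exact prod_eq_zero (mem_univ i) (sub_self _))
  have hZclosed : IsClosed Z := by
    have : Z = (Prod.fst ⁻¹' Set.Icc (0 : ℝ) 1) ∩
        ⋂ z, {q : ℝ × (ι → ℂ) | ∏ i, (z - q.2 i) = G q.1 z} := by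
      ext q; simp [hZ]
    rw [this]
    refine (isClosed_Icc.preimage continuous_fst).inter (isClosed_iInter fun z => ?_)
    exact isClosed_eq (by fun_prop) ((hG z).comp continuous_fst)
  have hZcompact : IsCompact Z := by
    refine (isCompact_Icc (a := (0 : ℝ)) (b := 1)).prod
      (isCompact_univ_pi fun _ : ι => isCompact_closedBall (0 : ℂ) R) |>.of_isClosed_subset hZclosed
      fun q hq => ⟨hq.1, fun i _ => ?_⟩
    simpa using (hZroot q hq i).2
  have hopen : ∀ Q : Multiset (Set ℂ) → Prop, IsOpen {x : ι → ℂ | (∀ i, x i ∈ U) ∧ Q (c x)} := by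
    intro Q
    rw [isOpen_iff_mem_nhds]
    rintro x ⟨hxU, hxQ⟩
    have : ∀ᶠ y in 𝓝 x, ∀ i, y i ∈ connectedComponentIn U (x i) := by
      rw [eventually_all]
      intro i
      exact (continuous_apply i).continuousAt.eventually
        (hU.connectedComponentIn.mem_nhds (mem_connectedComponentIn (hxU i)))
    filter_upwards [this] with y hy
    refine ⟨fun i => connectedComponentIn_subset _ _ (hy i), ?_⟩
    have : c y = c x := by
      simp only [hc]
      congr 1
      funext i
      exact (connectedComponentIn_eq (hy i)).symm
    rwa [this]
  -- Compactness of `Z` replaces a continuous choice of roots: any condition on the invariant cuts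
  -- out a closed set of times, so [0, 1] cannot split into two such sets.
  have hclosed : ∀ Q : Multiset (Set ℂ) → Prop,
      IsClosed (Prod.fst '' {q : ℝ × (ι → ℂ) | q ∈ Z ∧ Q (c q.2)}) := by
    intro Q
    have : {q : ℝ × (ι → ℂ) | q ∈ Z ∧ Q (c q.2)} =
        Z ∩ (Prod.snd ⁻¹' {x : ι → ℂ | (∀ i, x i ∈ U) ∧ ¬ Q (c x)})ᶜ := by
      ext q
      simp only [Set.mem_ofPred_eq, Set.mem_inter_iff, Set.mem_compl_iff, Set.mem_preimage,
        not_and, not_not]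
      exact ⟨fun h => ⟨h.1, fun _ => h.2⟩, fun h => ⟨h.1, h.2 fun i => (hZroot q h.1 i).1⟩⟩
    rw [this]
    exact ((hZcompact.inter_right ((hopen fun m => ¬ Q m).preimage continuous_snd).isClosed_compl).image
      continuous_fst).isClosed
  have hcxy : c x = c y := by
    by_contra hne
    obtain ⟨t, ht, ⟨q, ⟨hq, hqc⟩, rfl⟩, ⟨q', ⟨hq', hqc'⟩, hqq⟩⟩ :=
      isPreconnected_closed_iff.mp (isPreconnected_Icc (a := (0 : ℝ)) (b := 1)) _ _
        (hclosed fun m => m = c x) (hclosed fun m => m ≠ c x)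
        (fun t ht => by
          obtain ⟨w, hw⟩ := hex t ht
          by_cases h : c w = c x
          · exact Or.inl ⟨(t, w), ⟨⟨ht, hw⟩, h⟩, rfl⟩
          · exact Or.inr ⟨(t, w), ⟨⟨ht, hw⟩, h⟩, rfl⟩)
        ⟨0, by simp, (0, x), ⟨⟨by simp, hx⟩, rfl⟩, rfl⟩
        ⟨1, by simp, (1, y), ⟨⟨by simp, hy⟩, fun h => hne h.symm⟩, rfl⟩
    refine hqc' (Eq.trans (hceq (t := q.1) (fun z => ?_) hq.2) hqc)
    rw [hq'.2 z, hqq]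
  exact exists_perm_of_map_univ_eq hcxy

theorem exists_isEnumeration {s : Multiset ℂ} {N : ℕ} (h : s.card = N) :
    ∃ w : Fin N → ℂ, IsEnumeration s w := by
  obtain ⟨l, rfl⟩ := Quot.exists_rep s
  subst h
  exact ⟨l.get, (Fin.univ_val_map l.get).trans (by rw [List.ofFn_get]; rfl)⟩

theorem IsEnumeration.eq_prod_X_sub_C {p : ℂ[X]} (hp : p.Monic) {N : ℕ} {w : Fin N → ℂ}
    (h : IsEnumeration p.roots w) : p = ∏ i, (X - C (w i)) := by
  conv_lhs => rw [(IsAlgClosed.splits p).eq_prod_roots_of_monic hp, ← h, Multiset.map_map]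
  rfl

/-! ### Norm, eigenvalue and determinant estimates. -/

theorem star_dotProduct_self_eq {ι : Type*} [Fintype ι] (v : ι → ℂ) :
    star v ⬝ᵥ v = ((‖WithLp.toLp 2 v‖ ^ 2 : ℝ) : ℂ) := by
  rw [EuclideanSpace.norm_sq_eq, dotProduct]
  push_cast
  refine sum_congr rfl fun i _ => ?_
  rw [Pi.star_apply, RCLike.star_def, RCLike.conj_mul]
  rfl

section

variable {ι : Type*} [Fintype ι] [DecidableEq ι]

theorem norm_toLp_mulVec_le (M : Matrix ι ι ℂ) (v : ι → ℂ) :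
    ‖WithLp.toLp 2 (M.mulVec v)‖ ≤ ‖M‖ * ‖WithLp.toLp 2 v‖ := by
  simpa using Matrix.l2_opNorm_mulVec M (WithLp.toLp 2 v)

theorem exists_mulVec_eq_of_isRoot_charpoly {A : Matrix ι ι ℂ} {z : ℂ} (h : A.charpoly.eval z = 0) :
    ∃ v : ι → ℂ, v ≠ 0 ∧ A.mulVec v = z • v := by
  rw [Matrix.eval_charpoly] at h
  obtain ⟨v, hv, h0⟩ := Matrix.exists_mulVec_eq_zero_iff.mpr h
  refine ⟨v, hv, ?_⟩
  rw [Matrix.sub_mulVec, sub_eq_zero] at h0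
  rw [← h0]
  simp [Matrix.scalar_apply, ← Matrix.smul_one_eq_diagonal, Matrix.smul_mulVec]

theorem norm_le_of_eval_charpoly_eq_zero {A : Matrix ι ι ℂ} {z : ℂ} (h : A.charpoly.eval z = 0) :
    ‖z‖ ≤ ‖A‖ := by
  obtain ⟨v, hv, hz⟩ := exists_mulVec_eq_of_isRoot_charpoly h
  have := norm_toLp_mulVec_le A v
  rw [hz, WithLp.toLp_smul, norm_smul] at this
  exact le_of_mul_le_mul_right this (norm_pos_iff.mpr (by simpa using hv))

/-- In unitary eigencoordinates `w` the form is the sum of eigenvalues times |w_i|², and `w` has the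
norm of `v`. -/
theorem eigenvalues_mul_norm_sq_le {H : Matrix ι ι ℂ} (hH : H.IsHermitian) {m : ℝ}
    (hm : ∀ i, m ≤ hH.eigenvalues i) (v : ι → ℂ) :
    m * ‖WithLp.toLp 2 v‖ ^ 2 ≤ (star v ⬝ᵥ H.mulVec v).re := by
  set U : Matrix ι ι ℂ := (hH.eigenvectorUnitary).1
  have hUU : U * star U = 1 := Unitary.coe_mul_star_self _
  set w := (star U).mulVec v with hw
  have hsw : star w = Matrix.vecMul (star v) U := by
    rw [hw, Matrix.star_mulVec, Matrix.star_eq_conjTranspose, Matrix.conjTranspose_conjTranspose]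
  have hnorm : ‖WithLp.toLp 2 w‖ ^ 2 = ‖WithLp.toLp 2 v‖ ^ 2 := by
    have : star w ⬝ᵥ w = star v ⬝ᵥ v := by
      rw [hsw, ← Matrix.dotProduct_mulVec, hw, Matrix.mulVec_mulVec, hUU, Matrix.one_mulVec]
    rw [star_dotProduct_self_eq, star_dotProduct_self_eq] at this
    exact_mod_cast this
  have hHv : star v ⬝ᵥ H.mulVec v =
      star w ⬝ᵥ (Matrix.diagonal (RCLike.ofReal ∘ hH.eigenvalues)).mulVec w := by
    conv_lhs => rw [hH.spectral_theorem, Unitary.conjStarAlgAut_apply]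
    rw [hsw, ← Matrix.dotProduct_mulVec, hw, Matrix.mulVec_mulVec, Matrix.mulVec_mulVec,
      Matrix.mul_assoc]
  rw [hHv, ← hnorm, EuclideanSpace.norm_sq_eq, mul_sum, dotProduct, Complex.re_sum]
  refine sum_le_sum fun i _ => ?_
  have : star w i * (Matrix.diagonal (RCLike.ofReal ∘ hH.eigenvalues)).mulVec w i =
      ((hH.eigenvalues i * ‖w i‖ ^ 2 : ℝ) : ℂ) := by
    rw [Matrix.mulVec_diagonal, Pi.star_apply, RCLike.star_def, mul_left_comm, RCLike.conj_mul]
    simp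
  rw [this, Complex.ofReal_re]
  exact mul_le_mul_of_nonneg_right (hm i) (sq_nonneg _)

/-- A one-vector form of **Hadamard's inequality**. -/
theorem norm_det_mul_le (M : Matrix ι ι ℂ) (v : ι → ℂ) :
    ‖M.det‖ * ‖WithLp.toLp 2 v‖ ≤
      ‖WithLp.toLp 2 (M.mulVec v)‖ * ‖M‖ ^ (Fintype.card ι - 1) := by
  rcases eq_or_ne v 0 with rfl | hv
  · simp
  obtain ⟨j, -⟩ := Function.ne_iff.mp hv
  have : Nonempty ι := ⟨j⟩
  have hH : (M.conjTranspose * M).IsHermitian := Matrix.isHermitian_conjTranspose_mul_self M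
  -- The squared singular values multiply to |det M|². The least is at most ‖Mv‖²/‖v‖², each other
  -- at most ‖M‖².
  obtain ⟨k, hk⟩ := Finite.exists_min hH.eigenvalues
  have hMv : (star v ⬝ᵥ (M.conjTranspose * M).mulVec v).re = ‖WithLp.toLp 2 (M.mulVec v)‖ ^ 2 := by
    rw [← Matrix.mulVec_mulVec, Matrix.dotProduct_mulVec, ← Matrix.star_mulVec,
      star_dotProduct_self_eq, Complex.ofReal_re]
  have h1 : hH.eigenvalues k * ‖WithLp.toLp 2 v‖ ^ 2 ≤ ‖WithLp.toLp 2 (M.mulVec v)‖ ^ 2 :=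
    (eigenvalues_mul_norm_sq_le hH hk v).trans hMv.le
  have h0 : ∀ i, 0 ≤ hH.eigenvalues i := fun i => by
    have := hH.eigenvalues_eq i
    rw [this, ← Matrix.mulVec_mulVec, Matrix.dotProduct_mulVec, ← Matrix.star_mulVec,
      star_dotProduct_self_eq]
    exact sq_nonneg _
  have h2 : ∀ i, hH.eigenvalues i ≤ ‖M‖ ^ 2 := fun i => by
    have := norm_le_of_eval_charpoly_eq_zero (A := M.conjTranspose * M)
      (z := (hH.eigenvalues i : ℂ)) (by
        rw [hH.charpoly_eq, eval_prod]; exact prod_eq_zero (mem_univ i) (by simp))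
    rw [Matrix.l2_opNorm_conjTranspose_mul_self, Complex.norm_real, ← sq] at this
    exact (le_abs_self _).trans this
  have hdet : ‖M.det‖ ^ 2 = ∏ i, hH.eigenvalues i := by
    have h := hH.det_eq_prod_eigenvalues
    rw [Matrix.det_mul, Matrix.det_conjTranspose, RCLike.star_def, RCLike.conj_mul] at h
    exact_mod_cast h
  have h3 : ‖M.det‖ ^ 2 ≤ hH.eigenvalues k * (‖M‖ ^ 2) ^ (Fintype.card ι - 1) := by
    rw [hdet, ← mul_prod_erase univ _ (mem_univ k)]
    refine mul_le_mul_of_nonneg_left ?_ (h0 k)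
    refine (prod_le_prod (fun i _ => h0 i) fun i _ => h2 i).trans_eq ?_
    rw [prod_const, card_erase_of_mem (mem_univ k), card_univ]
  refine abs_le_of_sq_le_sq' ?_ (by positivity) |>.2
  calc (‖M.det‖ * ‖WithLp.toLp 2 v‖) ^ 2 = ‖M.det‖ ^ 2 * ‖WithLp.toLp 2 v‖ ^ 2 := mul_pow _ _ _
    _ ≤ hH.eigenvalues k * (‖M‖ ^ 2) ^ (Fintype.card ι - 1) * ‖WithLp.toLp 2 v‖ ^ 2 := by gcongr
    _ = (hH.eigenvalues k * ‖WithLp.toLp 2 v‖ ^ 2) * (‖M‖ ^ 2) ^ (Fintype.card ι - 1) := by ring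
    _ ≤ ‖WithLp.toLp 2 (M.mulVec v)‖ ^ 2 * (‖M‖ ^ 2) ^ (Fintype.card ι - 1) := by gcongr
    _ = _ := by rw [mul_pow, pow_right_comm]

/-- **Elsner's inequality**: the characteristic polynomial of `A` at an eigenvalue of `B`. -/
theorem norm_eval_charpoly_le {A B : Matrix ι ι ℂ} {z : ℂ} (h : B.charpoly.eval z = 0) :
    ‖A.charpoly.eval z‖ ≤ ‖A - B‖ * (‖A‖ + ‖B‖) ^ (Fintype.card ι - 1) := by
  obtain ⟨v, hv, hz⟩ := exists_mulVec_eq_of_isRoot_charpoly h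
  have hvp : 0 < ‖WithLp.toLp 2 v‖ := norm_pos_iff.mpr (by simpa using hv)
  rw [Matrix.eval_charpoly]
  set M : Matrix ι ι ℂ := Matrix.scalar ι z - A with hM
  -- On an eigenvector of `B` for `z`, the matrix z - A acts as B - A, which supplies the small
  -- factor.
  have hMv : M.mulVec v = (B - A).mulVec v := by
    rw [hM, Matrix.sub_mulVec, Matrix.sub_mulVec, hz]
    simp [Matrix.scalar_apply, ← Matrix.smul_one_eq_diagonal, Matrix.smul_mulVec]
  have hMn : ‖M‖ ≤ ‖A‖ + ‖B‖ := by
    have h1 : ‖Matrix.scalar ι z‖ ≤ ‖B‖ := by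
      rw [Matrix.scalar_apply, Matrix.l2_opNorm_diagonal]
      refine (pi_norm_le_iff_of_nonneg (norm_nonneg _)).mpr fun _ => ?_
      exact norm_le_of_eval_charpoly_eq_zero h
    calc ‖M‖ ≤ ‖Matrix.scalar ι z‖ + ‖A‖ := norm_sub_le _ _
      _ ≤ ‖A‖ + ‖B‖ := by linarith
  have hd := norm_det_mul_le M v
  rw [hMv] at hd
  have hb := norm_toLp_mulVec_le (B - A) v
  rw [norm_sub_rev] at hb
  refine le_of_mul_le_mul_right (hd.trans ?_) hvp
  calc _ ≤ (‖A - B‖ * ‖WithLp.toLp 2 v‖) * (‖A‖ + ‖B‖) ^ (Fintype.card ι - 1) := by gcongr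
    _ = _ := by ring

/-! ### Matching the spectra of two matrices. -/

/-- Since ‖A‖ ≤ ‖B‖, convexity bounds every matrix on the segment by ‖B‖, so Elsner's bound along
the path never exceeds its value at `B`. Strictness of `hr` puts all these spectra in an open
sublevel set, nonempty even if A = B. -/
theorem exists_perm_norm_sub_le_of_norm_le [Nonempty ι] {N : ℕ} (hN : Fintype.card ι = N)
    {A B : Matrix ι ι ℂ} (hAB : ‖A‖ ≤ ‖B‖) {x y : Fin N → ℂ}
    (hx : A.charpoly = ∏ i, (X - C (x i))) (hy : B.charpoly = ∏ i, (X - C (y i)))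
    {r : ℝ} (hr : ‖A - B‖ * (‖A‖ + ‖B‖) ^ (N - 1) < r) :
    ∃ π : Equiv.Perm (Fin N), ∀ i, 2 * (‖y (π i) - x i‖ / 4) ^ N ≤ r := by
  have hr0 : 0 < r := lt_of_le_of_lt (by positivity) hr
  set T : ℝ → Matrix ι ι ℂ := fun t => A + t • (B - A) with hT
  have hTle : ∀ t ∈ Set.Icc (0 : ℝ) 1, ‖T t‖ ≤ ‖B‖ := by
    rintro t ⟨h0, h1⟩
    have : T t = (1 - t) • A + t • B := by simp only [hT]; module
    rw [this]
    calc _ ≤ (1 - t) * ‖A‖ + t * ‖B‖ := by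
          refine (norm_add_le _ _).trans ?_
          rw [norm_smul, norm_smul, Real.norm_of_nonneg h0, Real.norm_of_nonneg (by linarith)]
      _ ≤ ‖B‖ := by nlinarith
  set U : Set ℂ := {z | ‖A.charpoly.eval z‖ < r} with hU
  have hUo : IsOpen U := isOpen_lt (A.charpoly.continuous.norm) continuous_const
  obtain ⟨π, hπ⟩ := exists_perm_connectedComponentIn_eq (ι := Fin N) hUo (R := ‖B‖)
    (G := fun t z => (T t).charpoly.eval z) (x := x) (y := y)
    (fun z => by
      simp only [Matrix.eval_charpoly, hT]
      fun_prop)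
    (fun t _ => by
      have hs := IsAlgClosed.splits (T t).charpoly
      have hcard : (T t).charpoly.roots.card = N := by
        rw [← hs.natDegree_eq_card_roots, Matrix.charpoly_natDegree_eq_dim, hN]
      obtain ⟨w, hw⟩ := exists_isEnumeration hcard
      refine ⟨w, fun z => ?_⟩
      simp [hw.eq_prod_X_sub_C (Matrix.charpoly_monic _), eval_prod])
    (fun t ht z hz => by
      refine ⟨lt_of_le_of_lt (norm_eval_charpoly_le hz) (lt_of_le_of_lt ?_ hr),
        (norm_le_of_eval_charpoly_eq_zero hz).trans (hTle t ht)⟩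
      rw [hN]
      have : ‖A - T t‖ ≤ ‖A - B‖ := by
        have h1 : A - T t = t • (A - B) := by simp only [hT]; module
        rw [h1, norm_smul, Real.norm_of_nonneg ht.1]
        exact mul_le_of_le_one_left (norm_nonneg _) ht.2
      have := hTle t ht
      gcongr)
    (fun z => by simp [hT, hx, eval_prod])
    (fun z => by simp [hT, hy, eval_prod])
  refine ⟨π, fun i => ?_⟩
  have : Nonempty (Fin N) := ⟨i⟩
  have hxU : ∀ j, x j ∈ U := fun j => by
    have : A.charpoly.eval (x j) = 0 := by
      rw [hx, eval_prod]; exact prod_eq_zero (mem_univ j) (by simp)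
    simp [hU, this, hr0]
  have hyU : y (π i) ∈ U := by
    have : B.charpoly.eval (y (π i)) = 0 := by
      rw [hy, eval_prod]; exact prod_eq_zero (mem_univ (π i)) (by simp)
    refine lt_of_le_of_lt (norm_eval_charpoly_le this) ?_
    rwa [hN]
  have := dist_le_of_isPreconnected (isPreconnected_connectedComponentIn (x := x i) (F := U))
    (mem_connectedComponentIn (hxU i))
    (show y (π i) ∈ _ by rw [← hπ i]; exact mem_connectedComponentIn hyU) x hr0
    (fun z hz => by
      have := connectedComponentIn_subset _ _ hz
      simp only [hU, Set.mem_ofPred_eq, hx, eval_prod, norm_prod] at this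
      simpa using this.le)
  simpa using this

/-- The **Bhatia–Elsner–Krause theorem** on the variation of the spectra of two matrices. -/
theorem variation_le_of_charpoly_eq [Nonempty ι] {N : ℕ} (hN : Fintype.card ι = N)
    {A B : Matrix ι ι ℂ} {x y : Fin N → ℂ}
    (hx : A.charpoly = ∏ i, (X - C (x i))) (hy : B.charpoly = ∏ i, (X - C (y i))) :
    variation x y ≤ 4 * (‖A - B‖ * (‖A‖ + ‖B‖) ^ (N - 1) / 2) ^ (1 / (N : ℝ)) := by
  have hN0 : N ≠ 0 := by rw [← hN]; exact Fintype.card_ne_zero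
  have : Nonempty (Fin N) := ⟨⟨0, Nat.pos_of_ne_zero hN0⟩⟩
  set r₀ := ‖A - B‖ * (‖A‖ + ‖B‖) ^ (N - 1) with hr₀
  have hr₀0 : 0 ≤ r₀ := by positivity
  -- The matching needs a strict bound, so `r` is taken above `r₀` and then sent to it; the
  -- permutation may depend on `r`, the variation does not.
  have key : ∀ r, r₀ < r → variation x y ≤ 4 * (r / 2) ^ (1 / (N : ℝ)) := by
    intro r hr
    have hr0 : 0 < r := hr₀0.trans_lt hr
    obtain ⟨π, hπ⟩ : ∃ π : Equiv.Perm (Fin N), ∀ i, 2 * (‖y (π i) - x i‖ / 4) ^ N ≤ r := by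
      rcases le_total ‖A‖ ‖B‖ with h | h
      · exact exists_perm_norm_sub_le_of_norm_le hN h hx hy hr
      · obtain ⟨π, hπ⟩ := exists_perm_norm_sub_le_of_norm_le hN h hy hx
          (by rwa [norm_sub_rev, add_comm ‖B‖])
        refine ⟨π.symm, fun i => ?_⟩
        have := hπ (π.symm i)
        rwa [Equiv.apply_symm_apply, norm_sub_rev] at this
    refine (ciInf_le (Set.finite_range _).bddBelow π).trans (ciSup_le fun i => ?_)
    have h1 : ‖y (π i) - x i‖ / 4 ≤ (r / 2) ^ (1 / (N : ℝ)) := by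
      rw [one_div, Real.le_rpow_inv_iff_of_pos (by positivity) (by positivity)
        (by exact_mod_cast Nat.pos_of_ne_zero hN0), Real.rpow_natCast]
      linarith [hπ i]
    linarith
  have hcont : ContinuousAt (fun r : ℝ => 4 * (r / 2) ^ (1 / (N : ℝ))) r₀ := by
    refine ContinuousAt.mul continuousAt_const (ContinuousAt.rpow_const (by fun_prop) (Or.inr ?_))
    positivity
  refine ge_of_tendsto (x := 𝓝[>] r₀) (hcont.tendsto.mono_left nhdsWithin_le_nhds) ?_
  filter_upwards [self_mem_nhdsWithin] with r hr using key r hr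

end

/-! ### Tropical roots of a quadratic max-times polynomial. -/

theorem tropicalRoot_cases {a b c x : ℝ} (h : IsTropicalRoot ![a, b, c] x) :
    0 ≤ x ∧ ((a = b * x ∧ c * x ^ 2 ≤ a) ∨ (a = c * x ^ 2 ∧ b * x ≤ a) ∨
      (b * x = c * x ^ 2 ∧ a ≤ b * x)) := by
  obtain ⟨h0, i, j, hij, hi, hj⟩ := h
  refine ⟨h0, ?_⟩
  have hle : ∀ k : Fin 3, (![a, b, c] : Fin 3 → ℝ) k * x ^ (k : ℕ) ≤ maxTimesEval ![a, b, c] x :=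
    fun k => le_sup' (fun k : Fin 3 => (![a, b, c] : Fin 3 → ℝ) k * x ^ (k : ℕ)) (mem_univ k)
  have e0 := hle 0
  have e1 := hle 1
  have e2 := hle 2
  fin_cases i <;> fin_cases j <;> simp at hij hi hj e0 e1 e2 <;> grind

theorem tropicalRoots_eq {a b c x y : ℝ} (ha : 0 ≤ a) (hb : 0 ≤ b) (hc : 0 < c) (hxy : y < x)
    (hx : IsTropicalRoot ![a, b, c] x) (hy : IsTropicalRoot ![a, b, c] y) :
    0 < b ∧ x = b / c ∧ y = a / b := by
  obtain ⟨hx0, hx⟩ := tropicalRoot_cases hx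
  obtain ⟨hy0, hy⟩ := tropicalRoot_cases hy
  have hxp : 0 < x := hy0.trans_lt hxy
  have hb0 : 0 < b := by
    refine hb.lt_of_ne' ?_
    rintro rfl
    have h1 : a = c * x ^ 2 := by
      rcases hx with h | h | h <;> nlinarith [mul_pos hc (pow_pos hxp 2)]
    have h2 : a ≤ c * y ^ 2 := by
      rcases hy with h | h | h <;> nlinarith [mul_pos hc (pow_pos hxp 2), mul_nonneg hc.le (sq_nonneg y)]
    have : y ^ 2 < x ^ 2 := by gcongr
    nlinarith
  have hsq : c * y ^ 2 < c * x ^ 2 := by gcongr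
  have hlin : b * y < b * x := by gcongr
  -- If `a` attained the maximum at `x`, it would strictly exceed both other monomials at the
  -- smaller point `y`, leaving no tie there.
  have hx1 : b * x = c * x ^ 2 ∧ a ≤ b * x := by
    rcases hx with h | h | h
    · rcases hy with h' | h' | h' <;> linarith
    · rcases hy with h' | h' | h' <;> linarith
    · exact h
  have hbx : b = c * x := mul_right_cancel₀ hxp.ne' (by linarith)
  have hy1 : a = b * y := by
    rcases hy0.eq_or_lt with rfl | hyp
    · rcases hy with h' | h' | h' <;> linarith
    · have : c * y ^ 2 < b * y := by rw [hbx, sq, ← mul_assoc]; gcongr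
      rcases hy with h' | h' | h' <;> linarith
  refine ⟨hb0, ?_, ?_⟩
  · rw [eq_div_iff hc.ne']
    linarith
  · rw [eq_div_iff hb0.ne']; linarith

section

variable {n : ℕ}

/-! ### Linearization by the scaled companion matrix. -/

theorem matrixPoly_eval_det_three (A₀ A₁ A₂ : Matrix (Fin n) (Fin n) ℂ) (z : ℂ) :
    (matrixPoly ![A₀, A₁, A₂]).det.eval z = (A₀ + z • A₁ + z ^ 2 • A₂).det := by
  rw [← coe_evalRingHom, RingHom.map_det]
  congr 1
  ext i j
  simp [matrixPoly, Fin.sum_univ_three, Matrix.add_apply]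
  ring

theorem matrixPoly_eval_det_two (A₀ A₁ : Matrix (Fin n) (Fin n) ℂ) (z : ℂ) :
    (matrixPoly ![A₀, A₁]).det.eval z = (A₀ + z • A₁).det := by
  rw [← coe_evalRingHom, RingHom.map_det]
  congr 1
  ext i j
  simp [matrixPoly, Fin.sum_univ_two, Matrix.add_apply]
  ring

/-- The companion matrix of the monic quadratic matrix polynomial `z ^ 2 + z B₁ + B₀`, scaled
by `a`. -/
noncomputable def companion (a : ℂ) (B₀ B₁ : Matrix (Fin n) (Fin n) ℂ) :
    Matrix (Fin n ⊕ Fin n) (Fin n ⊕ Fin n) ℂ :=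
  Matrix.fromBlocks (-B₁) (-(a⁻¹ • B₀)) (a • 1) 0

theorem eval_charpoly_companion {a : ℂ} (ha : a ≠ 0) (B₀ B₁ : Matrix (Fin n) (Fin n) ℂ) (z : ℂ) :
    (companion a B₀ B₁).charpoly.eval z = (B₀ + z • B₁ + z ^ 2 • (1 : Matrix _ _ ℂ)).det := by
  have hs : Matrix.scalar (Fin n ⊕ Fin n) z - companion a B₀ B₁ =
      Matrix.fromBlocks (z • 1 + B₁) (a⁻¹ • B₀) (-(a • 1)) (z • 1) := by
    rw [companion, Matrix.scalar_apply, ← Matrix.smul_one_eq_diagonal, ← Matrix.fromBlocks_one,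
      Matrix.fromBlocks_smul, sub_eq_add_neg, Matrix.fromBlocks_neg, Matrix.fromBlocks_add]
    simp
  -- A product of block shears, hence of determinant 1. Its first block column (z, a) makes (z -
  -- companion) * `T` block upper triangular, with the quadratic polynomial and 1 on the diagonal.
  set T : Matrix (Fin n ⊕ Fin n) (Fin n ⊕ Fin n) ℂ :=
    Matrix.fromBlocks 1 (((z - 1) * a⁻¹) • 1) 0 1 * Matrix.fromBlocks 1 0 (a • 1) 1 *
      Matrix.fromBlocks 1 (-(a⁻¹ • 1)) 0 1 with hT
  have hTd : T.det = 1 := by simp [hT, Matrix.det_mul]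
  have hTe : T = Matrix.fromBlocks (z • 1) (-(a⁻¹ • 1)) (a • 1) 0 := by
    rw [hT, Matrix.fromBlocks_multiply, Matrix.fromBlocks_multiply]
    congr 1 <;> simp [smul_smul, ha]
    match_scalars
    field_simp
    ring
  rw [Matrix.eval_charpoly, ← mul_one (Matrix.det _), ← hTd, ← Matrix.det_mul, hs, hTe,
    Matrix.fromBlocks_multiply]
  have h1 : (z • 1 + B₁) * (z • 1) + a⁻¹ • B₀ * a • 1 = B₀ + z • B₁ + z ^ 2 • (1 : Matrix _ _ ℂ) := by
    simp [smul_smul, ha, sq]; abel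
  have h2 : -(a • 1) * (z • 1) + z • 1 * a • (1 : Matrix (Fin n) (Fin n) ℂ) = 0 := by
    simp [smul_smul, mul_comm]
  have h3 : -(a • 1) * -(a⁻¹ • 1) + z • 1 * (0 : Matrix (Fin n) (Fin n) ℂ) = 1 := by
    simp [smul_smul, ha]
  rw [h1, h2, h3, Matrix.det_fromBlocks_zero₂₁, Matrix.det_one, mul_one]

theorem spec_quadratic {a : ℂ} (ha : a ≠ 0) (A₀ A₁ : Matrix (Fin n) (Fin n) ℂ)
    {A₂ : Matrix (Fin n) (Fin n) ℂ} (hA₂ : IsUnit A₂) :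
    spec ![A₀, A₁, A₂] = (companion a (A₂⁻¹ * A₀) (A₂⁻¹ * A₁)).charpoly.roots := by
  have hd : IsUnit A₂.det := (Matrix.isUnit_iff_isUnit_det A₂).mp hA₂
  have : (matrixPoly ![A₀, A₁, A₂]).det =
      C A₂.det * (companion a (A₂⁻¹ * A₀) (A₂⁻¹ * A₁)).charpoly := by
    refine Polynomial.funext fun z => ?_
    rw [eval_mul, eval_C, eval_charpoly_companion ha, matrixPoly_eval_det_three, ← Matrix.det_mul]
    congr 1
    simp [mul_add, Matrix.mul_nonsing_inv_cancel_left _ _ hd]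
  rw [spec, this, roots_C_mul _ hd.ne_zero]

theorem spec_linear (A₁ : Matrix (Fin n) (Fin n) ℂ)
    {A₂ : Matrix (Fin n) (Fin n) ℂ} (hA₂ : IsUnit A₂) :
    spec ![A₁, A₂] = (-(A₂⁻¹ * A₁)).charpoly.roots := by
  have hd : IsUnit A₂.det := (Matrix.isUnit_iff_isUnit_det A₂).mp hA₂
  have : (matrixPoly ![A₁, A₂]).det = C A₂.det * (-(A₂⁻¹ * A₁)).charpoly := by
    refine Polynomial.funext fun z => ?_
    rw [eval_mul, eval_C, Matrix.eval_charpoly, matrixPoly_eval_det_two, ← Matrix.det_mul,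
      Matrix.scalar_apply, ← Matrix.smul_one_eq_diagonal]
    congr 1
    simp [mul_add, Matrix.mul_nonsing_inv_cancel_left _ _ hd, add_comm]
  rw [spec, this, roots_C_mul _ hd.ne_zero]

theorem card_roots_charpoly {ι : Type*} [Fintype ι] [DecidableEq ι] (A : Matrix ι ι ℂ) :
    A.charpoly.roots.card = Fintype.card ι := by
  rw [← (IsAlgClosed.splits A.charpoly).natDegree_eq_card_roots, Matrix.charpoly_natDegree_eq_dim]

theorem norm_one_le {ι : Type*} [Fintype ι] [DecidableEq ι] : ‖(1 : Matrix ι ι ℂ)‖ ≤ 1 := by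
  rw [← Matrix.diagonal_one, Matrix.l2_opNorm_diagonal]
  exact (pi_norm_le_iff_of_nonneg zero_le_one).mpr fun _ => by simp

theorem norm_fromBlocks_le (A B C D : Matrix (Fin n) (Fin n) ℂ) :
    ‖Matrix.fromBlocks A B C D‖ ≤ ‖A‖ + ‖B‖ + ‖C‖ + ‖D‖ := by
  -- `E` and `F` are the isometric inclusions of the two summands; each block, placed by them, keeps
  -- its norm bound.
  set E : Matrix (Fin n ⊕ Fin n) (Fin n) ℂ := Matrix.fromRows 1 0 with hE
  set F : Matrix (Fin n ⊕ Fin n) (Fin n) ℂ := Matrix.fromRows 0 1 with hF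
  have hE1 : ‖E‖ ≤ 1 := by
    have : E.conjTranspose * E = 1 := by
      rw [hE, Matrix.conjTranspose_fromRows_eq_fromCols_conjTranspose,
        Matrix.fromCols_mul_fromRows]
      simp
    have h := Matrix.l2_opNorm_conjTranspose_mul_self E
    rw [this] at h
    nlinarith [norm_one_le (ι := Fin n), norm_nonneg E]
  have hF1 : ‖F‖ ≤ 1 := by
    have : F.conjTranspose * F = 1 := by
      rw [hF, Matrix.conjTranspose_fromRows_eq_fromCols_conjTranspose,
        Matrix.fromCols_mul_fromRows]
      simp
    have h := Matrix.l2_opNorm_conjTranspose_mul_self F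
    rw [this] at h
    nlinarith [norm_one_le (ι := Fin n), norm_nonneg F]
  have hmul : ∀ (G H : Matrix (Fin n ⊕ Fin n) (Fin n) ℂ) (M : Matrix (Fin n) (Fin n) ℂ),
      ‖G‖ ≤ 1 → ‖H‖ ≤ 1 → ‖G * M * H.conjTranspose‖ ≤ ‖M‖ := fun G H M hG hH => by
    calc ‖G * M * H.conjTranspose‖ ≤ ‖G * M‖ * ‖H.conjTranspose‖ := Matrix.l2_opNorm_mul _ _
      _ ≤ (‖G‖ * ‖M‖) * ‖H‖ := by
        rw [Matrix.l2_opNorm_conjTranspose]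
        exact mul_le_mul_of_nonneg_right (Matrix.l2_opNorm_mul _ _) (norm_nonneg _)
      _ ≤ (1 * ‖M‖) * 1 := by gcongr
      _ = ‖M‖ := by ring
  have hsum : Matrix.fromBlocks A B C D = E * A * E.conjTranspose + E * B * F.conjTranspose +
      F * C * E.conjTranspose + F * D * F.conjTranspose := by
    simp only [hE, hF, Matrix.conjTranspose_fromRows_eq_fromCols_conjTranspose,
      Matrix.fromRows_mul]
    ext (i | i) (j | j) <;> simp
  rw [hsum]
  have h1 := hmul E E A hE1 hE1
  have h2 := hmul E F B hE1 hF1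
  have h3 := hmul F E C hF1 hE1
  have h4 := hmul F F D hF1 hF1
  exact (norm_add_le_of_le (norm_add_le_of_le (norm_add_le_of_le h1 h2) h3) h4)

/-- Applying the inverse `B` to Av = zv gives v = zBv. -/
theorem one_le_norm_mul_of_eval_charpoly_eq_zero {ι : Type*} [Fintype ι] [DecidableEq ι]
    {A B : Matrix ι ι ℂ} (hAB : A * B = 1)
    {z : ℂ} (h : A.charpoly.eval z = 0) : 1 ≤ ‖B‖ * ‖z‖ := by
  obtain ⟨v, hv, hz⟩ := exists_mulVec_eq_of_isRoot_charpoly h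
  have := norm_toLp_mulVec_le B (A.mulVec v)
  rw [Matrix.mulVec_mulVec, mul_eq_one_comm.mp hAB, Matrix.one_mulVec, hz,
    WithLp.toLp_smul, norm_smul, ← mul_assoc] at this
  exact le_of_mul_le_mul_right ((one_mul _).trans_le this) (norm_pos_iff.mpr (by simpa using hv))

theorem charpoly_companion_zero (a : ℂ) (B₁ : Matrix (Fin n) (Fin n) ℂ) {ξ : Fin n → ℂ}
    (h : IsEnumeration (-B₁).charpoly.roots ξ) :
    (companion a 0 B₁).charpoly =
      ∏ i, (X - C (Fin.append ξ (fun _ : Fin n => (0 : ℂ)) i)) := by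
  rw [companion, smul_zero, neg_zero, Matrix.charpoly_fromBlocks_zero₁₂,
    h.eq_prod_X_sub_C (Matrix.charpoly_monic _), Fin.prod_univ_add]
  simp only [Fin.append_left, Fin.append_right]
  simp

theorem norm_companion_le {a : ℝ} (ha : 0 < a) (B₀ B₁ : Matrix (Fin n) (Fin n) ℂ) :
    ‖companion a B₀ B₁‖ ≤ ‖B₁‖ + a⁻¹ * ‖B₀‖ + a := by
  refine (norm_fromBlocks_le _ _ _ _).trans ?_
  rw [norm_neg, norm_neg, norm_zero, norm_smul, norm_smul, norm_inv, Complex.norm_of_nonneg ha.le]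
  nlinarith [norm_one_le (ι := Fin n)]

theorem norm_companion_sub_le {a : ℝ} (ha : 0 < a) (B₀ B₁ : Matrix (Fin n) (Fin n) ℂ) :
    ‖companion a B₀ B₁ - companion a 0 B₁‖ ≤ a⁻¹ * ‖B₀‖ := by
  rw [companion, companion, sub_eq_add_neg, Matrix.fromBlocks_neg, Matrix.fromBlocks_add]
  refine (norm_fromBlocks_le _ _ _ _).trans ?_
  simp [norm_smul, abs_of_pos ha]

/-- Here `a` is meant as α⁺ and `ε` as 1/δ. The two companion norms are at most a(1 + κ + κε) and
a(1 + κ); their difference comes from the `B₀` block alone. -/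
theorem variation_companion_le [NeZero n] {a κ : ℝ} (ha : 0 < a) (hκ : 0 ≤ κ) {ε : ℝ} (hε : 0 ≤ ε)
    {B₀ B₁ : Matrix (Fin n) (Fin n) ℂ} (h₁ : ‖B₁‖ ≤ a * κ) (h₀ : ‖B₀‖ ≤ a ^ 2 * (κ * ε))
    {ξ : Fin n → ℂ} (hξ : IsEnumeration (-B₁).charpoly.roots ξ) {lam : Fin (n + n) → ℂ}
    (hlam : IsEnumeration (companion a B₀ B₁).charpoly.roots lam) :
    variation lam (Fin.append ξ fun _ => 0) ≤
      4 * (a * (κ * ε) * (a * (2 + 2 * κ + κ * ε)) ^ (n + n - 1) / 2) ^ (1 / ((n + n : ℕ) : ℝ)) := by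
  refine (variation_le_of_charpoly_eq (by simp)
    (hlam.eq_prod_X_sub_C (Matrix.charpoly_monic _)) (charpoly_companion_zero a B₁ hξ)).trans ?_
  have hB : a⁻¹ * ‖B₀‖ ≤ a * (κ * ε) := by
    rw [inv_mul_le_iff₀ ha]; linarith
  have hX := norm_companion_le ha B₀ B₁
  have hY := norm_companion_le ha 0 B₁
  rw [norm_zero, mul_zero] at hY
  have hsum : ‖companion a B₀ B₁‖ + ‖companion a 0 B₁‖ ≤ a * (2 + 2 * κ + κ * ε) := by linarith
  have hsub := (norm_companion_sub_le ha B₀ B₁).trans hB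
  gcongr

/-- Regrouping of the Bhatia–Elsner–Krause bound. -/
theorem four_mul_rpow_eq (hn : 1 ≤ n) {a κ δ : ℝ} (ha : 0 < a) (hκ : 0 ≤ κ) (hδ : 0 ≤ δ) :
    4 * (a * (κ * δ⁻¹) * (a * (2 + 2 * κ + κ * δ⁻¹)) ^ (n + n - 1) / 2) ^
      (1 / ((n + n : ℕ) : ℝ)) = splittingConst n κ δ * a / δ ^ (1 / (2 * (n : ℝ))) := by
  have hN : ((n + n : ℕ) : ℝ) = 2 * (n : ℝ) := by push_cast; ring
  have hn0 : (0 : ℝ) < 2 * n := by positivity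
  set s : ℝ := 2 + 2 * κ + κ * δ⁻¹ with hs
  have hs0 : 0 < s := by positivity
  set p : ℝ := 1 / (2 * (n : ℝ)) with hp
  have hsp : (s ^ (n + n - 1)) ^ p = s ^ (1 - p) := by
    rw [← Real.rpow_natCast, ← Real.rpow_mul hs0.le, Nat.cast_sub (by omega), hN]
    congr 1
    rw [hp]; field_simp; simp
  have hap : (a ^ (n + n)) ^ p = a := by
    rw [← Real.rpow_natCast, ← Real.rpow_mul ha.le, hN, hp, mul_one_div_cancel hn0.ne',
      Real.rpow_one]
  -- One factor `a` from the perturbation and 2n - 1 from the norms give a^(2n), whose 2n-th root is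
  -- `a`.
  have hr : a * (κ * δ⁻¹) * (a * s) ^ (n + n - 1) / 2 =
      a ^ (n + n) * (κ * (δ⁻¹ * (s ^ (n + n - 1) * 2⁻¹))) := by
    obtain ⟨m, hm⟩ : ∃ m, n + n = m + 1 := ⟨n + n - 1, by omega⟩
    rw [hm, Nat.add_sub_cancel, mul_pow]; ring
  rw [hN, hr, ← hp, Real.mul_rpow (by positivity) (by positivity),
    Real.mul_rpow hκ (by positivity), Real.mul_rpow (by positivity) (by positivity),
    Real.mul_rpow (by positivity) (by positivity), hap, hsp, Real.inv_rpow hδ,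
    Real.inv_rpow (x := 2) (by norm_num), ← Real.rpow_neg (x := 2) (by norm_num)]
  rw [splittingConst, ← hp, div_eq_mul_inv κ δ, ← hs, div_eq_mul_inv]
  ring

end

end

end TropicalSplitting


/-- Tropical splitting of eigenvalues. When `A₀ = 0` one has `αm = 0`, so that the separation
`δ = αp / αm` is infinite and the bound on the variation is to be read as `0`; this is also the
value that division by zero gives to the right-hand side below. -/
theorem mainTheorem1 (n : ℕ) (hn : 1 ≤ n) (A₀ A₁ A₂ : Matrix (Fin n) (Fin n) ℂ)
    (hA₂ : IsUnit A₂) (αp αm : ℝ) (hlt : αm < αp)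
    (hαp : TropicalSplitting.IsTropicalRoot ![‖A₀‖, ‖A₁‖, ‖A₂‖] αp)
    (hαm : TropicalSplitting.IsTropicalRoot ![‖A₀‖, ‖A₁‖, ‖A₂‖] αm) :
    αp = ‖A₁‖ / ‖A₂‖ ∧ αm = ‖A₀‖ / ‖A₁‖ ∧
    (TropicalSplitting.spec ![A₀, A₁, A₂]).card = n + n ∧
    (TropicalSplitting.spec ![A₁, A₂]).card = n ∧
    ∀ ξ : Fin n → ℂ, TropicalSplitting.IsEnumeration (TropicalSplitting.spec ![A₁, A₂]) ξ →
      (∀ lam : Fin (n + n) → ℂ,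
        TropicalSplitting.IsEnumeration (TropicalSplitting.spec ![A₀, A₁, A₂]) lam →
          TropicalSplitting.variation lam (Fin.append ξ (fun _ : Fin n => (0 : ℂ))) ≤
            TropicalSplitting.splittingConst n (TropicalSplitting.cond A₂) (αp / αm) * αp
              / (αp / αm) ^ (1 / (2 * (n : ℝ)))) ∧
      (∀ i : Fin n, αp * (TropicalSplitting.cond A₁)⁻¹ ≤ ‖ξ i‖ ∧
        ‖ξ i‖ ≤ αp * TropicalSplitting.cond A₂) := by
  have : NeZero n := ⟨by omega⟩
  have hc : 0 < ‖A₂‖ := norm_pos_iff.mpr hA₂.ne_zero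
  obtain ⟨hb, hp, hm⟩ := TropicalSplitting.tropicalRoots_eq (norm_nonneg A₀) (norm_nonneg A₁) hc
    hlt hαp hαm
  have hp0 : 0 < αp := hp ▸ div_pos hb hc
  have hm0 : 0 ≤ αm := hαm.1
  have hpC : (αp : ℂ) ≠ 0 := by exact_mod_cast hp0.ne'
  have hκ : 0 ≤ TropicalSplitting.cond A₂ := by unfold TropicalSplitting.cond; positivity
  have hbp : ‖A₁‖ = αp * ‖A₂‖ := by rw [hp]; field_simp
  have ham : ‖A₀‖ = αm * ‖A₁‖ := by rw [hm]; field_simp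
  have hd : IsUnit A₂.det := (Matrix.isUnit_iff_isUnit_det A₂).mp hA₂
  have hB₁ : ‖A₂⁻¹ * A₁‖ ≤ αp * TropicalSplitting.cond A₂ := by
    refine (norm_mul_le _ _).trans_eq ?_
    rw [TropicalSplitting.cond, hbp]; ring
  -- ‖A₀‖ = α⁻α⁺‖A₂‖ = (α⁺)²δ⁻¹‖A₂‖; for α⁻ = 0 the convention for division by zero still gives δ⁻¹
  -- = 0.
  have hB₀ : ‖A₂⁻¹ * A₀‖ ≤ αp ^ 2 * (TropicalSplitting.cond A₂ * (αp / αm)⁻¹) := by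
    refine (norm_mul_le _ _).trans_eq ?_
    rw [TropicalSplitting.cond, ham, hbp, inv_div]; field_simp
  refine ⟨hp, hm, ?_, ?_, fun ξ hξ => ⟨fun lam hlam => ?_, fun i => ?_⟩⟩
  · rw [TropicalSplitting.spec_quadratic hpC _ _ hA₂, TropicalSplitting.card_roots_charpoly]
    simp
  · rw [TropicalSplitting.spec_linear _ hA₂, TropicalSplitting.card_roots_charpoly]
    simp
  · rw [TropicalSplitting.spec_quadratic hpC _ _ hA₂] at hlam
    rw [TropicalSplitting.spec_linear _ hA₂] at hξ
    rw [← TropicalSplitting.four_mul_rpow_eq hn hp0 hκ (div_nonneg hp0.le hm0)]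
    exact TropicalSplitting.variation_companion_le hp0 hκ (by positivity) hB₁ hB₀ hξ hlam
  · rw [TropicalSplitting.spec_linear _ hA₂] at hξ
    have hroot : (-(A₂⁻¹ * A₁)).charpoly.eval (ξ i) = 0 := by
      rw [hξ.eq_prod_X_sub_C (Matrix.charpoly_monic _), Polynomial.eval_prod]
      exact Finset.prod_eq_zero (Finset.mem_univ i) (by simp)
    constructor
    · by_cases h : IsUnit A₁
      · have hd₁ : IsUnit A₁.det := (Matrix.isUnit_iff_isUnit_det A₁).mp h
        have h1 := TropicalSplitting.one_le_norm_mul_of_eval_charpoly_eq_zero (B := -(A₁⁻¹ * A₂))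
          (by
            rw [neg_mul_neg, Matrix.mul_assoc, Matrix.mul_nonsing_inv_cancel_left _ _ hd₁,
              Matrix.nonsing_inv_mul _ hd]) hroot
        rw [norm_neg] at h1
        have h2 : ‖A₁⁻¹ * A₂‖ ≤ ‖A₁⁻¹‖ * ‖A₂‖ := norm_mul_le _ _
        have h3 : 0 < ‖A₁⁻¹‖ := norm_pos_iff.mpr (Matrix.isUnit_nonsing_inv_iff.mpr h).ne_zero
        have h4 : αp * (TropicalSplitting.cond A₁)⁻¹ = (‖A₁⁻¹‖ * ‖A₂‖)⁻¹ := by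
          rw [TropicalSplitting.cond, hbp]; field_simp
        rw [h4, inv_le_iff_one_le_mul₀' (by positivity)]
        exact h1.trans (mul_le_mul_of_nonneg_right h2 (norm_nonneg _))
      -- For singular `A₁` the inverse is 0 by convention, so the lower bound is 0.
      · rw [TropicalSplitting.cond, Matrix.nonsing_inv_apply_not_isUnit _
          fun h' => h ((Matrix.isUnit_iff_isUnit_det A₁).mpr h')]
        simp
    · exact (TropicalSplitting.norm_le_of_eval_charpoly_eq_zero hroot).trans (by rwa [norm_neg])
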